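/- Call a sequence $(n_k)_{k\ge 0}$ of real numbers lacunary if it is increasing and there is a constant $\beta>1$ with $n_{k+1}/n_k\ge\beta$ for all $k\ge 0$ (so that all $n_k$ are positive). For a locally integrable function $f$ on $\mathbb{R}$ put $$A_{n_k}f(x)=\frac{1}{n_k}\int_0^{n_k}f(x-t)\,dt,\qquad \mathcal{V}_sf(x)=\Big(\sum_{k=1}^\infty|A_{n_k}f(x)-A_{n_{k-1}}f(x)|^s\Big)^{1/s}.$$ Let $H^1(\mathbb{R})$ be the (atomic) Hardy space of all $f\in L^1(\mathbb{R})$ that can be written as $f=\sum_j\lambda_ja_j$ with convergence in $L^1(\mathbb{R})$, where $\sum_j|\lambda_j|<\infty$ and each $a_j$ is an atom, i.e. a measurable function supported in a bounded interval $I_j$ with $\|a_j\|_\infty\le 1/|I_j|$ and $\int a_j=0$; the norm $\|f\|_{H^1(\mathbb{R})}$ is the infimum of $\sum_j|\lambda_j|$ over all such representations. Theorem. Let $2\le s<\infty$ and let $(n_k)$ be a lacunary sequence. Then there exists a constant $C>0$ such that, for all $f\in H^1(\mathbb{R})$, $\mathcal{V}_sf\in L^1(\mathbb{R})$ and $$\|\mathcal{V}_sf\|_{L^1(\mathbb{R})}\le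 C\,\|f\|_{H^1(\mathbb{R})}.$$ -/

import Mathlib

open MeasureTheory Filter Topology
open scoped ENNReal NNReal

/-- A lacunary sequence: increasing, with ratios of consecutive terms at least some `β > 1`.
(These two conditions force every `n k` to be positive, see `IsLacunary.pos`.) -/
def IsLacunary (n : ℕ → ℝ) : Prop :=
  Monotone n ∧ ∃ β : ℝ, 1 < β ∧ ∀ k, β ≤ n (k + 1) / n k

theorem IsLacunary.pos {n : ℕ → ℝ} (hn : IsLacunary n) (k : ℕ) : 0 < n k := by
  obtain ⟨hmono, β, hβ, h⟩ := hn
  by_contra hk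
  have hk' : n k ≤ 0 := not_lt.mp hk
  have hβk := h k
  rcases hk'.lt_or_eq with hneg | hzero
  · have h1 : n (k + 1) ≤ β * n k := (le_div_iff_of_neg hneg).mp hβk
    have h2 : n k ≤ n (k + 1) := hmono (Nat.le_succ k)
    nlinarith
  · rw [hzero, div_zero] at hβk
    linarith

/-- The one-sided average `(1/r) ∫₀^r f(x - t) dt`. -/
noncomputable def oneSidedAverage (r : ℝ) (f : ℝ → ℂ) (x : ℝ) : ℂ :=
  (r : ℂ)⁻¹ * ∫ t in (0 : ℝ)..r, f (x - t)

/-- The one-sided `s`-variation operator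
`(∑_{k ≥ 1} |A_{n_k} f(x) - A_{n_{k-1}} f(x)|^s)^{1/s}`, with values in `[0, ∞]`. -/
noncomputable def variationOp (s : ℝ) (n : ℕ → ℝ) (f : ℝ → ℂ) (x : ℝ) : ℝ≥0∞ :=
  (∑' k : ℕ, ‖oneSidedAverage (n (k + 1)) f x - oneSidedAverage (n k) f x‖ₑ ^ s) ^ (1 / s)

/-- An `H¹(ℝ)` atom: a measurable function supported in a bounded interval `I`,
bounded by `1/|I|`, with mean zero. -/
def IsH1Atom (a : ℝ → ℂ) : Prop :=
  AEStronglyMeasurable a volume ∧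
  (∃ u v : ℝ, u < v ∧ (∀ᵐ x, x ∉ Set.Icc u v → a x = 0) ∧ (∀ᵐ x, ‖a x‖ ≤ (v - u)⁻¹)) ∧
  ∫ x, a x = 0

/-- `f = ∑ⱼ cⱼ aⱼ` with convergence in `L¹(ℝ)`, where the `aⱼ` are atoms and `∑ⱼ |cⱼ| < ∞`. -/
def IsAtomicDecomposition (f : ℝ → ℂ) (c : ℕ → ℂ) (a : ℕ → ℝ → ℂ) : Prop :=
  (∀ j, IsH1Atom (a j)) ∧
  Summable (fun j => ‖c j‖) ∧
  Tendsto (fun N : ℕ => eLpNorm (fun x => f x - ∑ j ∈ Finset.range N, c j * a j x) 1 volume)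
    atTop (𝓝 0)

/-- Membership in the real-variable Hardy space `H¹(ℝ)`. -/
def MemH1 (f : ℝ → ℂ) : Prop :=
  Integrable f volume ∧ ∃ (c : ℕ → ℂ) (a : ℕ → ℝ → ℂ), IsAtomicDecomposition f c a

/-- The atomic `H¹(ℝ)` norm: the infimum of `∑ⱼ |cⱼ|` over all atomic decompositions. -/
noncomputable def h1Norm (f : ℝ → ℂ) : ℝ≥0∞ :=
  ⨅ (c : ℕ → ℂ) (a : ℕ → ℝ → ℂ) (_ : IsAtomicDecomposition f c a), ∑' j, ‖c j‖ₑ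

/-! Countable subadditivity along an atomic decomposition
(`variationOp_le_tsum_of_isAtomicDecomposition`) reduces the theorem to a bound on `∫ 𝒱ₛ a` that is
uniform over atoms `a` (`lintegral_variationOp_atom_le`). Let `a` live on `I = [u, v]`, and split
the line at `I* = [u, 2v - u]`.

On `I*`, `𝒱ₛ ≤ 𝒱₂`, and `𝒱₂` is bounded on `L²`. By Plancherel this is a bound on `∑ₖ |mₖ(ξ)|²`,
where `mₖ` is the difference of two dilates of the Fourier transform of `1_(0,1]`. It is
`O(min(n_{k+1}|ξ|, 1/(n_k|ξ|)))`, and lacunarity makes the squares summable uniformly in `ξ`.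

Off `I*` the cancellation of `a` is exact: a window `(x - r, x]` either misses `I`, contains `I`
(mean zero), or has its left end in `I`. So `A_r a` lives on a translate of `I`, is at most `1/r`
there, and matters only for `r ≥ |I|`. Thus `∑ |I|/n_k` over `n_k ≥ |I|` suffices. -/

open FourierTransform SchwartzMap in
/-- The `L²` Fourier transform of an integrable function is given by the Fourier integral. -/
theorem fourier_toLp_ae_eq {f : ℝ → ℂ} (hf : Integrable f) (hf2 : MemLp f 2) :
    ∀ᵐ ξ, (𝓕 (hf2.toLp f) : Lp ℂ 2 (volume : Measure ℝ)) ξ = 𝓕 f ξ := by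
  have hcont : Continuous (𝓕 f) :=
    VectorFourier.fourierIntegral_continuous Real.continuous_fourierChar
      (by exact continuous_inner) hf
  -- Against a test function both sides move the transform onto it: on the `L²` side through
  -- tempered distributions, on the `L¹` side by Fubini.
  apply ae_eq_of_integral_contDiff_smul_eq
  · exact (Lp.memLp _).locallyIntegrable (by norm_num)
  · exact hcont.locallyIntegrable
  intro g hg hgs
  have hg1 : ContDiff ℝ (⊤ : ℕ∞) (fun x => (g x : ℂ)) := Complex.ofRealCLM.contDiff.comp hg
  have hg2 : HasCompactSupport (fun x => (g x : ℂ)) :=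
    hgs.comp_left (g := fun y : ℝ => (y : ℂ)) (by simp)
  set φ : 𝓢(ℝ, ℂ) := hg2.toSchwartzMap hg1 with hφ
  have hφa : ∀ x, φ x = (g x : ℂ) := fun x => by simp [hφ]
  have h1 := DFunLike.congr_fun (Lp.fourier_toTemperedDistribution_eq (hf2.toLp f)) φ
  rw [TemperedDistribution.fourier_apply, Lp.toTemperedDistribution_apply,
    Lp.toTemperedDistribution_apply] at h1
  have h2 : ∫ x, (𝓕 φ) x • (hf2.toLp f) x = ∫ x, (𝓕 φ) x • f x := by
    apply integral_congr_ae
    filter_upwards [hf2.coeFn_toLp] with x hx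
    rw [hx]
  have h3 : ∫ x, (𝓕 φ) x • f x = ∫ x, φ x • 𝓕 f x := by
    have := VectorFourier.integral_fourierIntegral_smul_eq_flip (L := innerₗ ℝ)
      (μ := volume) (ν := volume) Real.continuous_fourierChar continuous_inner
      φ.integrable hf
    rw [flip_innerₗ] at this
    exact this
  have h4 : ∀ F : ℝ → ℂ, ∫ x, g x • F x = ∫ x, φ x • F x := fun F => by
    simp [hφa]
  rw [h4, h4, ← h1, h2, h3]

open FourierTransform in
/-- Plancherel's theorem for functions in `L¹ ∩ L²`. -/
theorem lintegral_enorm_fourier_sq {f : ℝ → ℂ} (hf : Integrable f) (hf2 : MemLp f 2) :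
    ∫⁻ ξ, ‖𝓕 f ξ‖ₑ ^ (2 : ℝ) = ∫⁻ x, ‖f x‖ₑ ^ (2 : ℝ) := by
  have h1 : eLpNorm (𝓕 f) 2 volume = eLpNorm f 2 volume := by
    rw [← eLpNorm_congr_ae (fourier_toLp_ae_eq hf hf2), ← Lp.enorm_def,
      ← eLpNorm_congr_ae hf2.coeFn_toLp, ← Lp.enorm_def, ← ofReal_norm, ← ofReal_norm,
      Lp.norm_fourier_eq]
  have key : ∀ g : ℝ → ℂ, ∫⁻ x, ‖g x‖ₑ ^ (2 : ℝ) = eLpNorm g 2 volume ^ (2 : ℝ) := fun g => by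
    rw [eLpNorm_eq_lintegral_rpow_enorm_toReal (by norm_num) (by norm_num), ← ENNReal.rpow_mul]
    simp
  rw [key, key, h1]

/-! ### Inequalities for `ℓ^p` sums -/

/-- The `ℓ^q` norm is at most the `ℓ^p` norm when `p ≤ q`. -/
theorem ENNReal.tsum_rpow_rpow_le {ι : Type*} (b : ι → ℝ≥0∞) {p q : ℝ} (hp : 0 < p) (hpq : p ≤ q) :
    (∑' i, b i ^ q) ^ (1 / q) ≤ (∑' i, b i ^ p) ^ (1 / p) := by
  have hq : 0 < q := hp.trans_le hpq
  set S := (∑' i, b i ^ p) ^ (1 / p) with hS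
  have hSp : ∑' i, b i ^ p = S ^ p := by
    rw [hS, ← ENNReal.rpow_mul, one_div_mul_cancel hp.ne', ENNReal.rpow_one]
  have hb : ∀ i, b i ≤ S := fun i => by
    rw [← ENNReal.rpow_le_rpow_iff hp, ← hSp]
    exact ENNReal.le_tsum i
  have : ∑' i, b i ^ q ≤ S ^ q := by
    calc ∑' i, b i ^ q ≤ ∑' i, S ^ (q - p) * b i ^ p := by
          refine ENNReal.tsum_le_tsum fun i => ?_
          calc b i ^ q = b i ^ (q - p) * b i ^ p := by
                rw [← ENNReal.rpow_add_of_nonneg _ _ (by linarith) hp.le, sub_add_cancel]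
            _ ≤ _ := by gcongr; exact hb i
      _ = S ^ q := by
          rw [ENNReal.tsum_mul_left, hSp, ← ENNReal.rpow_add_of_nonneg _ _ (by linarith) hp.le,
            sub_add_cancel]
  calc (∑' i, b i ^ q) ^ (1 / q) ≤ (S ^ q) ^ (1 / q) := by gcongr
    _ = S := by rw [← ENNReal.rpow_mul, mul_one_div_cancel hq.ne', ENNReal.rpow_one]

/-- Minkowski's inequality for a finite sum of nonnegative sequences. -/
theorem ENNReal.Lp_sum_le {ι κ : Type*} (s : Finset ι) (t : Finset κ) (g : κ → ι → ℝ≥0∞)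
    {p : ℝ} (hp : 1 ≤ p) :
    (∑ i ∈ s, (∑ j ∈ t, g j i) ^ p) ^ (1 / p) ≤ ∑ j ∈ t, (∑ i ∈ s, g j i ^ p) ^ (1 / p) := by
  classical
  have hp0 : 0 < p := by linarith
  induction t using Finset.induction_on with
  | empty => simp [hp0]
  | insert j t hj ih =>
    simp only [Finset.sum_insert hj]
    exact (ENNReal.Lp_add_le s _ _ hp).trans (by gcongr)

/-! ### Telescoping estimates along lacunary sequences -/

/-- Size estimate for the terms of a lacunary square function: a quantity which is small both near
zero and near infinity is controlled by increments of bounded monotone sequences. -/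
theorem sq_le_increments {β a b y : ℝ} (hβ : 1 < β) (ha : 0 < a) (hab : β * a ≤ b) (hy : 0 ≤ y)
    (h1 : y ≤ 2) (h2 : y ≤ 13 * b) (h3 : y ≤ 1 / a) :
    y ^ 2 ≤ 169 * (β / (β - 1)) *
      ((min 1 b - min 1 a) + (min 1 (1 / a) - min 1 (1 / b))) := by
  have hβ1 : 0 < β - 1 := by linarith
  have hβ0 : 0 < β := by linarith
  have hb : 0 < b := by nlinarith
  have hle : a ≤ b := by nlinarith
  have hmon1 : min 1 a ≤ min 1 b := min_le_min le_rfl hle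
  have hmon2 : min 1 (1 / b) ≤ min 1 (1 / a) :=
    min_le_min le_rfl (one_div_le_one_div_of_le ha hle)
  have hc : 0 ≤ 169 * (β / (β - 1)) := by positivity
  have hinv : 1 / b ≤ (1 / a) / β := by
    rw [div_div]; exact one_div_le_one_div_of_le (by positivity) (by linarith)
  rcases le_or_gt b 1 with hb1 | hb1
  -- As `a ≤ b / β`, the increment `b - a` is a fixed fraction of `b`.
  · have : b ≤ β / (β - 1) * (b - a) := by
      rw [div_mul_eq_mul_div, le_div_iff₀ hβ1]; nlinarith
    have e : min 1 b - min 1 a = b - a := by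
      rw [min_eq_right hb1, min_eq_right (hle.trans hb1)]
    calc y ^ 2 ≤ (13 * b) ^ 2 := by gcongr
      _ ≤ 169 * b := by nlinarith
      _ ≤ 169 * (β / (β - 1)) * (b - a) := by linarith
      _ ≤ _ := by rw [e]; gcongr; linarith
  rcases le_or_gt 1 a with ha1 | ha1
  · have hA : 1 / a ≤ 1 := by rw [div_le_one ha]; exact ha1
    have hA0 : 0 < 1 / a := by positivity
    have : 1 / a ≤ β / (β - 1) * (1 / a - 1 / b) := by
      rw [div_mul_eq_mul_div, le_div_iff₀ hβ1]
      have : β * (1 / b) ≤ 1 / a := by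
        rw [le_div_iff₀ hβ0] at hinv; linarith
      nlinarith
    have e : min 1 (1 / a) - min 1 (1 / b) = 1 / a - 1 / b := by
      rw [min_eq_right hA, min_eq_right]
      exact (one_div_le_one_div_of_le ha hle).trans hA
    calc y ^ 2 ≤ (1 / a) ^ 2 := by gcongr
      _ ≤ 1 / a := by nlinarith
      _ ≤ 169 * (1 / a) := by linarith
      _ ≤ 169 * (β / (β - 1)) * (1 / a - 1 / b) := by linarith
      _ ≤ _ := by rw [e]; gcongr; linarith
  -- Here `a < 1 < b`: the two increments add up to at least `1 - a/b ≥ 1 - 1/β`, so the trivial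
  -- bound on `y` is enough.
  · have hB : 1 / b ≤ 1 := by rw [div_le_one hb]; exact hb1.le
    have hA : 1 ≤ 1 / a := by rw [one_le_div ha]; exact ha1.le
    rw [min_eq_left hb1.le, min_eq_right ha1.le, min_eq_left hA, min_eq_right hB]
    have h4 : a * (1 / b) ≤ 1 / β := by
      calc a * (1 / b) ≤ a * (1 / a / β) := by gcongr
        _ = 1 / β := by field_simp
    have h5 : 1 - 1 / β ≤ (1 - a) + (1 - 1 / b) := by
      nlinarith [mul_nonneg (sub_nonneg.2 ha1.le) (sub_nonneg.2 hB)]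
    calc y ^ 2 ≤ 2 ^ 2 := by gcongr
      _ ≤ 169 * (β / (β - 1)) * (1 - 1 / β) := by
        have : β / (β - 1) * (1 - 1 / β) = 1 := by field_simp
        rw [mul_assoc, this]; norm_num
      _ ≤ _ := by gcongr

/-- Along a lacunary sequence, `∑_{n_k ≥ R} 1 / n_k ≤ C / R`. -/
theorem sum_indicator_inv_le {n : ℕ → ℝ} {β : ℝ} (hβ : 1 < β) (hpos : ∀ k, 0 < n k)
    (hn : ∀ k, β * n k ≤ n (k + 1)) {R : ℝ} (hR : 0 < R) (K : ℕ) :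
    ∑ k ∈ Finset.range K, (if R ≤ n k then R / n k else 0) ≤ β / (β - 1) := by
  have hβ1 : 0 < β - 1 := by linarith
  -- Lacunarity makes `R / n k` comparable to its own drop at the next index, so the sum telescopes.
  have key : ∀ k, (if R ≤ n k then R / n k else 0) ≤
      β / (β - 1) * (min 1 (R / n k) - min 1 (R / n (k + 1))) := by
    intro k
    have hk := hpos k
    have hk' := hpos (k + 1)
    have hle : n k ≤ n (k + 1) := by nlinarith [hn k]
    have hd : R / n (k + 1) ≤ R / n k := by gcongr
    split_ifs with h
    · have hA : R / n k ≤ 1 := by rw [div_le_one hk]; exact h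
      rw [min_eq_right hA, min_eq_right (hd.trans hA), div_mul_eq_mul_div, le_div_iff₀ hβ1]
      have : β * (R / n (k + 1)) ≤ R / n k := by
        rw [mul_div_assoc', div_le_div_iff₀ hk' hk]
        nlinarith [hn k]
      nlinarith
    · have := min_le_min (le_refl (1 : ℝ)) hd
      have : 0 ≤ β / (β - 1) := by positivity
      apply mul_nonneg this; linarith
  calc _ ≤ ∑ k ∈ Finset.range K, β / (β - 1) * (min 1 (R / n k) - min 1 (R / n (k + 1))) :=
        Finset.sum_le_sum fun k _ => key k
    _ = β / (β - 1) * (min 1 (R / n 0) - min 1 (R / n K)) := by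
        rw [← Finset.mul_sum, Finset.sum_range_sub']
    _ ≤ β / (β - 1) * 1 := by
        gcongr
        have : 0 ≤ min 1 (R / n K) := le_min zero_le_one (div_nonneg hR.le (hpos K).le)
        linarith [min_le_left 1 (R / n 0)]
    _ = _ := mul_one _

/-! ### The averaging kernel and its Fourier transform -/

/-- The convolution kernel `r⁻¹ 1_{(0, r]}` of the one-sided average. -/
noncomputable def averagingKernel (r : ℝ) : ℝ → ℂ :=
  (Set.Ioc 0 r).indicator fun _ => (r : ℂ)⁻¹

theorem integrable_averagingKernel (r : ℝ) : Integrable (averagingKernel r) :=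
  (integrable_indicator_iff measurableSet_Ioc).2 (integrableOn_const (by simp))

theorem averagingKernel_mul_integral {r : ℝ} (hr : 0 < r) (g : ℝ → ℂ) :
    ∫ t, averagingKernel r t * g t = (r : ℂ)⁻¹ * ∫ t in (0 : ℝ)..r, g t := by
  rw [intervalIntegral.integral_of_le hr.le, ← integral_const_mul,
    ← integral_indicator measurableSet_Ioc]
  congr 1
  ext t
  by_cases ht : t ∈ Set.Ioc 0 r <;> simp [averagingKernel, ht]

open Convolution in
theorem oneSidedAverage_eq_convolution {r : ℝ} (hr : 0 < r) (f : ℝ → ℂ) :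
    oneSidedAverage r f = (averagingKernel r ⋆[ContinuousLinearMap.mul ℂ ℂ] f) := by
  ext x
  rw [oneSidedAverage, convolution_def, ← averagingKernel_mul_integral hr]
  rfl

theorem integrable_oneSidedAverage {r : ℝ} (hr : 0 < r) {f : ℝ → ℂ} (hf : Integrable f) :
    Integrable (oneSidedAverage r f) := by
  rw [oneSidedAverage_eq_convolution hr]
  exact (integrable_averagingKernel r).integrable_convolution _ hf

theorem oneSidedAverage_eq_integral_Ioc {r : ℝ} (hr : 0 < r) (f : ℝ → ℂ) (x : ℝ) :
    oneSidedAverage r f x = (r : ℂ)⁻¹ * ∫ t in Set.Ioc (x - r) x, f t := by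
  rw [oneSidedAverage, intervalIntegral.integral_comp_sub_left (fun t => f t), sub_zero,
    intervalIntegral.integral_of_le (by linarith)]

theorem norm_oneSidedAverage_le {r : ℝ} (hr : 0 < r) {f : ℝ → ℂ} (hf : Integrable f) (x : ℝ) :
    ‖oneSidedAverage r f x‖ ≤ r⁻¹ * ∫ t, ‖f t‖ := by
  rw [oneSidedAverage_eq_integral_Ioc hr, norm_mul, norm_inv, Complex.norm_real,
    Real.norm_of_nonneg hr.le]
  gcongr
  exact (norm_integral_le_integral_norm _).trans
    (setIntegral_le_integral hf.norm (Eventually.of_forall fun _ => norm_nonneg _))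

theorem memLp_two_oneSidedAverage {r : ℝ} (hr : 0 < r) {f : ℝ → ℂ} (hf : Integrable f) :
    MemLp (oneSidedAverage r f) 2 := by
  have h := integrable_oneSidedAverage hr hf
  rw [memLp_two_iff_integrable_sq_norm h.1]
  simp_rw [sq]
  exact h.norm.bdd_mul h.1.norm (Eventually.of_forall fun x => by
    simpa using norm_oneSidedAverage_le hr hf x)

open FourierTransform in
theorem fourier_oneSidedAverage {r : ℝ} (hr : 0 < r) {f : ℝ → ℂ} (hf : Integrable f) (ξ : ℝ) :
    𝓕 (oneSidedAverage r f) ξ = 𝓕 (averagingKernel r) ξ * 𝓕 f ξ := by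
  rw [oneSidedAverage_eq_convolution hr,
    Real.fourier_mul_convolution_eq (integrable_averagingKernel r) hf]

open FourierTransform in
theorem fourier_averagingKernel {r : ℝ} (hr : 0 < r) (ξ : ℝ) :
    𝓕 (averagingKernel r) ξ =
      (r : ℂ)⁻¹ * ∫ t in (0 : ℝ)..r, Complex.exp (Complex.I * (-2 * Real.pi * ξ * t : ℝ)) := by
  rw [← averagingKernel_mul_integral hr, Real.fourier_real_eq_integral_exp_smul]
  congr 1
  ext t
  rw [smul_eq_mul, mul_comm]
  congr 2
  push_cast
  ring

open FourierTransform in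
theorem norm_fourier_averagingKernel_le_one {r : ℝ} (hr : 0 < r) (ξ : ℝ) :
    ‖𝓕 (averagingKernel r) ξ‖ ≤ 1 := by
  have h := intervalIntegral.norm_integral_le_of_norm_le_const (a := 0) (b := r) (C := 1)
    (f := fun t : ℝ => Complex.exp (Complex.I * (-2 * Real.pi * ξ * t : ℝ)))
    (fun t _ => by rw [Complex.norm_exp_I_mul_ofReal])
  rw [sub_zero, abs_of_pos hr, one_mul] at h
  rw [fourier_averagingKernel hr, norm_mul, norm_inv, Complex.norm_real,
    Real.norm_of_nonneg hr.le]
  rw [inv_mul_le_iff₀ hr, mul_one]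
  exact h

open FourierTransform in
theorem norm_fourier_averagingKernel_sub_one_le {r : ℝ} (hr : 0 < r) (ξ : ℝ) :
    ‖𝓕 (averagingKernel r) ξ - 1‖ ≤ 2 * Real.pi * (r * |ξ|) := by
  have h := intervalIntegral.norm_integral_le_of_norm_le_const (a := 0) (b := r)
    (C := 2 * Real.pi * (r * |ξ|))
    (f := fun t : ℝ => Complex.exp (Complex.I * (-2 * Real.pi * ξ * t : ℝ)) - 1)
    (fun t ht => by
      rw [Set.uIoc_of_le hr.le] at ht
      refine (Real.norm_exp_I_mul_ofReal_sub_one_le).trans ?_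
      rw [Real.norm_eq_abs, abs_mul, abs_mul, abs_mul, abs_neg, abs_of_pos Real.pi_pos,
        abs_of_pos ht.1, abs_two]
      have := mul_le_mul_of_nonneg_right ht.2 (by positivity : 0 ≤ 2 * Real.pi * |ξ|)
      linarith)
  rw [intervalIntegral.integral_sub (by apply Continuous.intervalIntegrable; fun_prop)
    (by simp), intervalIntegral.integral_const, sub_zero, abs_of_pos hr] at h
  have hr' : (r : ℂ) ≠ 0 := by exact_mod_cast hr.ne'
  have e : 𝓕 (averagingKernel r) ξ - 1 = (r : ℂ)⁻¹ *
      ((∫ t in (0 : ℝ)..r, Complex.exp (Complex.I * (-2 * Real.pi * ξ * t : ℝ))) -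
        r • (1 : ℂ)) := by
    rw [fourier_averagingKernel hr, mul_sub, Complex.real_smul, mul_one, inv_mul_cancel₀ hr']
  rw [e, norm_mul, norm_inv, Complex.norm_real, Real.norm_of_nonneg hr.le,
    inv_mul_le_iff₀ hr]
  linarith

open FourierTransform in
theorem norm_fourier_averagingKernel_le {r : ℝ} (hr : 0 < r) {ξ : ℝ} (hξ : ξ ≠ 0) :
    ‖𝓕 (averagingKernel r) ξ‖ ≤ 1 / (Real.pi * (r * |ξ|)) := by
  have hc : (Complex.I * (-2 * Real.pi * ξ : ℝ) : ℂ) ≠ 0 := by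
    refine mul_ne_zero Complex.I_ne_zero ?_
    have := Real.pi_pos.ne'
    exact_mod_cast (by positivity : (-2 * Real.pi * ξ) ≠ 0)
  have e : ∀ t : ℝ, Complex.I * (-2 * Real.pi * ξ * t : ℝ) =
      (Complex.I * (-2 * Real.pi * ξ : ℝ)) * t := fun t => by push_cast; ring
  have hden : ‖(Complex.I * (-2 * Real.pi * ξ : ℝ) : ℂ)‖ = 2 * Real.pi * |ξ| := by
    rw [norm_mul, Complex.norm_I, Complex.norm_real, Real.norm_eq_abs, abs_mul, abs_mul, abs_neg,
      abs_of_pos Real.pi_pos, abs_two, one_mul]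
  have hnum : ‖Complex.exp (Complex.I * (-2 * Real.pi * ξ * r : ℝ)) -
      Complex.exp (Complex.I * (-2 * Real.pi * ξ * (0 : ℝ) : ℝ))‖ ≤ 2 := by
    refine (norm_sub_le _ _).trans ?_
    rw [Complex.norm_exp_I_mul_ofReal, Complex.norm_exp_I_mul_ofReal]
    norm_num
  have hξ' : 0 < |ξ| := abs_pos.2 hξ
  rw [fourier_averagingKernel hr]
  simp_rw [e] at hnum ⊢
  rw [integral_exp_mul_complex hc, norm_mul, norm_inv, Complex.norm_real,
    Real.norm_of_nonneg hr.le, norm_div, hden]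
  calc _ ≤ r⁻¹ * (2 / (2 * Real.pi * |ξ|)) := by gcongr
    _ = _ := by field_simp

/-! ### `L²` theory of the square function -/

open FourierTransform in
/-- The multipliers of consecutive differences of averages along a lacunary sequence are
square summable, uniformly in the frequency. -/
theorem sum_norm_fourier_averagingKernel_sub_sq_le {n : ℕ → ℝ} {β : ℝ} (hβ : 1 < β)
    (hpos : ∀ k, 0 < n k) (hn : ∀ k, β * n k ≤ n (k + 1)) {ξ : ℝ} (hξ : ξ ≠ 0) (K : ℕ) :
    ∑ k ∈ Finset.range K,
      ‖𝓕 (averagingKernel (n (k + 1))) ξ - 𝓕 (averagingKernel (n k)) ξ‖ ^ 2 ≤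
        338 * (β / (β - 1)) := by
  have hξ' : 0 < |ξ| := abs_pos.2 hξ
  have hpi := Real.pi_gt_three
  have hpi' := Real.pi_lt_d2
  have hβ1 : 0 < β - 1 := by linarith
  set ψ : ℕ → ℝ := fun k => min 1 (n k * |ξ|)
  set χ : ℕ → ℝ := fun k => min 1 (1 / (n k * |ξ|))
  have key : ∀ k, ‖𝓕 (averagingKernel (n (k + 1))) ξ - 𝓕 (averagingKernel (n k)) ξ‖ ^ 2 ≤
      169 * (β / (β - 1)) * ((ψ (k + 1) - ψ k) + (χ k - χ (k + 1))) := by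
    intro k
    have hk := hpos k
    have hk' := hpos (k + 1)
    have hle : n k ≤ n (k + 1) := by nlinarith [hn k]
    have ha : 0 < n k * |ξ| := by positivity
    have hb : 0 < n (k + 1) * |ξ| := by positivity
    have hab : n k * |ξ| ≤ n (k + 1) * |ξ| := by gcongr
    refine sq_le_increments hβ ha ?_ (norm_nonneg _) ?_ ?_ ?_
    · rw [← mul_assoc]; gcongr; exact hn k
    · refine (norm_sub_le _ _).trans ?_
      linarith [norm_fourier_averagingKernel_le_one hk ξ,
        norm_fourier_averagingKernel_le_one hk' ξ]
    -- Both multipliers are within `2π n_{k+1}|ξ|` of `1`; the constant 13 comes from `4π < 13`.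
    · have h1 := norm_fourier_averagingKernel_sub_one_le hk ξ
      have h2 := norm_fourier_averagingKernel_sub_one_le hk' ξ
      have h3 := norm_sub_le (𝓕 (averagingKernel (n (k + 1))) ξ - 1)
        (𝓕 (averagingKernel (n k)) ξ - 1)
      rw [sub_sub_sub_cancel_right] at h3
      nlinarith
    · have h1 := norm_fourier_averagingKernel_le hk hξ
      have h2 := norm_fourier_averagingKernel_le hk' hξ
      have h3 := norm_sub_le (𝓕 (averagingKernel (n (k + 1))) ξ) (𝓕 (averagingKernel (n k)) ξ)
      have h4 : 1 / (Real.pi * (n (k + 1) * |ξ|)) ≤ 1 / (Real.pi * (n k * |ξ|)) := by gcongr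
      have h5 : 1 / (Real.pi * (n k * |ξ|)) ≤ 1 / (2 * (n k * |ξ|)) := by gcongr; linarith
      have h6 : 1 / (2 * (n k * |ξ|)) + 1 / (2 * (n k * |ξ|)) = 1 / (n k * |ξ|) := by
        field_simp
        norm_num
      linarith
  have hψ : ψ K - ψ 0 ≤ 1 := by
    have h0 : 0 ≤ ψ 0 := le_min zero_le_one (mul_nonneg (hpos 0).le hξ'.le)
    linarith [min_le_left 1 (n K * |ξ|)]
  have hχ : χ 0 - χ K ≤ 1 := by
    have h0 : 0 ≤ χ K :=
      le_min zero_le_one (one_div_nonneg.2 (mul_nonneg (hpos K).le hξ'.le))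
    linarith [min_le_left 1 (1 / (n 0 * |ξ|))]
  calc _ ≤ ∑ k ∈ Finset.range K,
        169 * (β / (β - 1)) * ((ψ (k + 1) - ψ k) + (χ k - χ (k + 1))) :=
        Finset.sum_le_sum fun k _ => key k
    _ = 169 * (β / (β - 1)) * ((ψ K - ψ 0) + (χ 0 - χ K)) := by
        rw [← Finset.mul_sum, Finset.sum_add_distrib, Finset.sum_range_sub, Finset.sum_range_sub']
    _ ≤ 169 * (β / (β - 1)) * (1 + 1) := by gcongr
    _ = _ := by ring

open FourierTransform in
/-- The `L²` bound for the square function along a lacunary sequence. -/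
theorem lintegral_tsum_oneSidedAverage_sub_sq_le {n : ℕ → ℝ} {β : ℝ} (hβ : 1 < β)
    (hpos : ∀ k, 0 < n k) (hn : ∀ k, β * n k ≤ n (k + 1)) {f : ℝ → ℂ} (hf : Integrable f)
    (hf2 : MemLp f 2) :
    ∫⁻ x, ∑' k, ‖oneSidedAverage (n (k + 1)) f x - oneSidedAverage (n k) f x‖ₑ ^ (2 : ℝ) ≤
      ENNReal.ofReal (338 * (β / (β - 1))) * ∫⁻ x, ‖f x‖ₑ ^ (2 : ℝ) := by
  have hint : ∀ k, Integrable (oneSidedAverage (n k) f) := fun k =>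
    integrable_oneSidedAverage (hpos k) hf
  have hcont : ∀ {g : ℝ → ℂ}, Integrable g → Continuous (𝓕 g) := fun hg =>
    VectorFourier.fourierIntegral_continuous Real.continuous_fourierChar
      (by exact continuous_inner) hg
  set m : ℕ → ℝ → ℂ := fun k ξ => 𝓕 (averagingKernel (n (k + 1))) ξ - 𝓕 (averagingKernel (n k)) ξ
  have hm : ∀ k, Continuous (m k) := fun k =>
    (hcont (integrable_averagingKernel _)).sub (hcont (integrable_averagingKernel _))
  have hk : ∀ k, ∫⁻ x, ‖oneSidedAverage (n (k + 1)) f x - oneSidedAverage (n k) f x‖ₑ ^ (2 : ℝ) =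
      ∫⁻ ξ, ‖m k ξ‖ₑ ^ (2 : ℝ) * ‖𝓕 f ξ‖ₑ ^ (2 : ℝ) := by
    intro k
    have h := lintegral_enorm_fourier_sq ((hint (k + 1)).sub (hint k))
      ((memLp_two_oneSidedAverage (hpos (k + 1)) hf).sub (memLp_two_oneSidedAverage (hpos k) hf))
    simp only [Pi.sub_apply] at h
    rw [← h]
    refine lintegral_congr fun ξ => ?_
    have e : 𝓕 (oneSidedAverage (n (k + 1)) f - oneSidedAverage (n k) f) ξ = m k ξ * 𝓕 f ξ := by
      have : 𝓕 (oneSidedAverage (n (k + 1)) f - oneSidedAverage (n k) f) ξ =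
          𝓕 (oneSidedAverage (n (k + 1)) f) ξ - 𝓕 (oneSidedAverage (n k) f) ξ := by
        simp only [Real.fourier_eq, Pi.sub_apply, smul_sub]
        exact integral_sub ((Real.fourierIntegral_convergent_iff ξ).2 (hint (k + 1)))
          ((Real.fourierIntegral_convergent_iff ξ).2 (hint k))
      rw [this, fourier_oneSidedAverage (hpos _) hf, fourier_oneSidedAverage (hpos _) hf, ← sub_mul]
    rw [e, enorm_mul, ENNReal.mul_rpow_of_nonneg _ _ (by norm_num)]
  rw [lintegral_tsum fun k => by
    exact (((hint (k + 1)).sub (hint k)).1.enorm.pow_const (2 : ℝ))]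
  simp_rw [hk]
  rw [← lintegral_tsum fun k => by
    exact ((hm k).enorm.measurable.pow_const _).aemeasurable.mul
      ((hcont hf).enorm.measurable.pow_const _).aemeasurable]
  rw [← lintegral_enorm_fourier_sq hf hf2, ← lintegral_const_mul _
    ((hcont hf).enorm.measurable.pow_const _)]
  apply lintegral_mono_ae
  filter_upwards [Measure.ae_ne volume (0 : ℝ)] with ξ hξ
  rw [ENNReal.tsum_mul_right]
  gcongr
  refine ENNReal.tsum_le_of_sum_range_le fun K => ?_
  have e : ∀ k, ‖m k ξ‖ₑ ^ (2 : ℝ) = ENNReal.ofReal (‖m k ξ‖ ^ 2) := fun k => by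
    rw [ENNReal.rpow_two, ENNReal.ofReal_pow (norm_nonneg _), ofReal_norm]
  simp_rw [e]
  rw [← ENNReal.ofReal_sum_of_nonneg fun _ _ => by positivity]
  exact ENNReal.ofReal_le_ofReal (sum_norm_fourier_averagingKernel_sub_sq_le hβ hpos hn hξ K)

/-! ### Pointwise bounds for the variation operator -/

theorem aemeasurable_variationOp (s : ℝ) {n : ℕ → ℝ} (hpos : ∀ k, 0 < n k) {f : ℝ → ℂ}
    (hf : Integrable f) : AEMeasurable (variationOp s n f) := by
  have h : ∀ k, AEMeasurable fun x =>
      ‖oneSidedAverage (n (k + 1)) f x - oneSidedAverage (n k) f x‖ₑ ^ s := fun k =>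
    ((integrable_oneSidedAverage (hpos (k + 1)) hf).sub
      (integrable_oneSidedAverage (hpos k) hf)).1.enorm.pow_const s
  exact (AEMeasurable.tsum h).pow_const _

/-- Either `V ≤ L⁻¹` or `V ≤ L V²`. With `L = |I|` this replaces Cauchy–Schwarz on the enlarged
interval. -/
theorem variationOp_two_le (n : ℕ → ℝ) (f : ℝ → ℂ) (x : ℝ) {L : ℝ≥0∞} (hL : L ≠ 0)
    (hL' : L ≠ ∞) :
    variationOp 2 n f x ≤ L * (∑' k,
      ‖oneSidedAverage (n (k + 1)) f x - oneSidedAverage (n k) f x‖ₑ ^ (2 : ℝ)) + L⁻¹ := by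
  set V := variationOp 2 n f x with hV
  have e : ∑' k, ‖oneSidedAverage (n (k + 1)) f x - oneSidedAverage (n k) f x‖ₑ ^ (2 : ℝ) =
      V * V := by
    rw [hV, variationOp, ← sq, ← ENNReal.rpow_two, ← ENNReal.rpow_mul]
    norm_num
  rw [e]
  rcases le_total V L⁻¹ with h | h
  · exact h.trans le_add_self
  · refine le_trans ?_ le_self_add
    calc V = L * L⁻¹ * V := by rw [ENNReal.mul_inv_cancel hL hL', one_mul]
      _ ≤ L * V * V := by gcongr
      _ = _ := mul_assoc _ _ _

/-- Each average enters at most two differences. This crude `ℓ¹` bound is used only far from the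
atom. -/
theorem variationOp_le_tsum {s : ℝ} (hs : 1 ≤ s) (n : ℕ → ℝ) (f : ℝ → ℂ) (x : ℝ) :
    variationOp s n f x ≤ 2 * ∑' k, ‖oneSidedAverage (n k) f x‖ₑ := by
  have h := ENNReal.tsum_rpow_rpow_le
    (fun k => ‖oneSidedAverage (n (k + 1)) f x - oneSidedAverage (n k) f x‖ₑ) one_pos hs
  simp only [ENNReal.rpow_one, div_one] at h
  refine h.trans ?_
  calc _ ≤ ∑' k, (‖oneSidedAverage (n (k + 1)) f x‖ₑ + ‖oneSidedAverage (n k) f x‖ₑ) :=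
        ENNReal.tsum_le_tsum fun k => enorm_sub_le
    _ = ∑' k, ‖oneSidedAverage (n (k + 1)) f x‖ₑ + ∑' k, ‖oneSidedAverage (n k) f x‖ₑ :=
        ENNReal.tsum_add
    _ ≤ ∑' k, ‖oneSidedAverage (n k) f x‖ₑ + ∑' k, ‖oneSidedAverage (n k) f x‖ₑ := by
        refine add_le_add_left ?_ _
        exact ENNReal.tsum_comp_le_tsum_of_injective (add_left_injective 1)
          (fun k => ‖oneSidedAverage (n k) f x‖ₑ)
    _ = _ := (two_mul _).symm

/-! ### Estimates for a single atom -/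

section Atom

variable {a : ℝ → ℂ} {u v : ℝ}

theorem norm_le_indicator_of_atom (hsupp : ∀ᵐ x, x ∉ Set.Icc u v → a x = 0)
    (hbd : ∀ᵐ x, ‖a x‖ ≤ (v - u)⁻¹) :
    ∀ᵐ x, ‖a x‖ ≤ (Set.Icc u v).indicator (fun _ => (v - u)⁻¹) x := by
  filter_upwards [hsupp, hbd] with x h1 h2
  by_cases hx : x ∈ Set.Icc u v
  · simpa [hx] using h2
  · simp [hx, h1 hx]

theorem memLp_of_atom (ha : AEStronglyMeasurable a)
    (hsupp : ∀ᵐ x, x ∉ Set.Icc u v → a x = 0) (hbd : ∀ᵐ x, ‖a x‖ ≤ (v - u)⁻¹) (p : ℝ≥0∞) :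
    MemLp a p :=
  (memLp_indicator_const p measurableSet_Icc (v - u)⁻¹ (Or.inr (by simp))).mono' ha
    (norm_le_indicator_of_atom hsupp hbd)

theorem integral_norm_le_one_of_atom (huv : u < v)
    (hsupp : ∀ᵐ x, x ∉ Set.Icc u v → a x = 0) (hbd : ∀ᵐ x, ‖a x‖ ≤ (v - u)⁻¹) :
    ∫ x, ‖a x‖ ≤ 1 := by
  have h0 : 0 < v - u := sub_pos.2 huv
  calc ∫ x, ‖a x‖ ≤ ∫ x, (Set.Icc u v).indicator (fun _ => (v - u)⁻¹) x :=
        integral_mono_of_nonneg (Eventually.of_forall fun _ => norm_nonneg _)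
          ((integrable_indicator_iff measurableSet_Icc).2 (integrableOn_const (by simp)))
          (norm_le_indicator_of_atom hsupp hbd)
    _ = 1 := by
        rw [integral_indicator measurableSet_Icc, setIntegral_const, smul_eq_mul,
          Measure.real, Real.volume_Icc, ENNReal.toReal_ofReal h0.le, mul_inv_cancel₀ h0.ne']

theorem lintegral_enorm_sq_le_of_atom (huv : u < v)
    (hsupp : ∀ᵐ x, x ∉ Set.Icc u v → a x = 0) (hbd : ∀ᵐ x, ‖a x‖ ≤ (v - u)⁻¹) :
    ∫⁻ x, ‖a x‖ₑ ^ (2 : ℝ) ≤ (ENNReal.ofReal (v - u))⁻¹ := by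
  have h0 : 0 < v - u := sub_pos.2 huv
  set L := ENNReal.ofReal (v - u) with hL
  have hL0 : L ≠ 0 := by simpa [hL] using huv
  have hLt : L ≠ ∞ := ENNReal.ofReal_ne_top
  calc ∫⁻ x, ‖a x‖ₑ ^ (2 : ℝ) ≤ ∫⁻ x, (Set.Icc u v).indicator (fun _ => L⁻¹ ^ 2) x := by
        apply lintegral_mono_ae
        filter_upwards [hsupp, hbd] with x h1 h2
        by_cases hx : x ∈ Set.Icc u v
        · rw [Set.indicator_of_mem hx, ENNReal.rpow_two, hL, ← ENNReal.ofReal_inv_of_pos h0,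
            ← ofReal_norm]
          gcongr
        · simp [hx, h1 hx]
    _ = L⁻¹ := by
        rw [lintegral_indicator measurableSet_Icc, setLIntegral_const, Real.volume_Icc, ← hL, sq,
          mul_assoc, ENNReal.inv_mul_cancel hL0 hLt, mul_one]

/-- Away from (an enlargement of) its supporting interval, the average of an atom over a window of
length `r` is supported in the translate of that interval by `r`. -/
theorem enorm_oneSidedAverage_atom_le (ha : IsH1Atom a) (huv : u < v)
    (hsupp : ∀ᵐ x, x ∉ Set.Icc u v → a x = 0) (hbd : ∀ᵐ x, ‖a x‖ ≤ (v - u)⁻¹) {r : ℝ}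
    (hr : 0 < r) {x : ℝ} (hx : x ∉ Set.Icc u (v + (v - u))) :
    ‖oneSidedAverage r a x‖ₑ ≤ (Set.Icc (u + r) (v + r)).indicator
      (fun _ => if v - u ≤ r then ENNReal.ofReal r⁻¹ else 0) x := by
  have hzero : Disjoint (Set.Ioc (x - r) x) (Set.Icc u v) → oneSidedAverage r a x = 0 := by
    intro hd
    rw [oneSidedAverage_eq_integral_Ioc hr, setIntegral_eq_zero_of_ae_eq_zero, mul_zero]
    filter_upwards [hsupp] with t ht h
    exact ht (Set.disjoint_left.1 hd h)
  by_cases hmem : x ∈ Set.Icc (u + r) (v + r)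
  · have hux : u ≤ x := by linarith [hmem.1]
    have hvx : v + (v - u) < x := by
      by_contra h
      exact hx ⟨hux, not_lt.1 h⟩
    have hur : v - u ≤ r := by linarith [hmem.2]
    rw [Set.indicator_of_mem hmem, if_pos hur, ← ofReal_norm]
    apply ENNReal.ofReal_le_ofReal
    refine (norm_oneSidedAverage_le hr
      (memLp_one_iff_integrable.1 (memLp_of_atom ha.1 hsupp hbd 1)) x).trans ?_
    exact mul_le_of_le_one_right (by positivity) (integral_norm_le_one_of_atom huv hsupp hbd)
  · rw [Set.indicator_of_notMem hmem, nonpos_iff_eq_zero, enorm_eq_zero]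
    rcases lt_or_ge x u with h1 | h1
    · apply hzero
      rw [Set.disjoint_left]
      intro t ht ht'
      linarith [ht.2, ht'.1]
    · have hvx : v + (v - u) < x := by
        by_contra h
        exact hx ⟨h1, not_lt.1 h⟩
      rcases lt_or_ge v (x - r) with h2 | h2
      · apply hzero
        rw [Set.disjoint_left]
        intro t ht ht'
        linarith [ht.1, ht'.2]
      · have h3 : x - r < u := by
          by_contra h
          exact hmem ⟨by linarith, by linarith⟩
        -- The window contains the whole support, so the mean-zero condition kills the average.
        rw [oneSidedAverage_eq_integral_Ioc hr, setIntegral_eq_integral_of_ae_compl_eq_zero,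
          ha.2.2, mul_zero]
        filter_upwards [hsupp] with t ht h
        apply ht
        intro h'
        exact h ⟨by linarith [h'.1], by linarith [h'.2]⟩

end Atom

theorem IsH1Atom.memLp {a : ℝ → ℂ} (ha : IsH1Atom a) (p : ℝ≥0∞) : MemLp a p := by
  obtain ⟨u, v, -, hsupp, hbd⟩ := ha.2.1
  exact memLp_of_atom ha.1 hsupp hbd p

theorem IsH1Atom.integrable {a : ℝ → ℂ} (ha : IsH1Atom a) : Integrable a :=
  memLp_one_iff_integrable.1 (ha.memLp 1)

/-- The variation operator along a lacunary sequence is uniformly bounded in `L¹` on atoms. -/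
theorem lintegral_variationOp_atom_le {s : ℝ} (hs : 2 ≤ s) {n : ℕ → ℝ} {β : ℝ} (hβ : 1 < β)
    (hpos : ∀ k, 0 < n k) (hn : ∀ k, β * n k ≤ n (k + 1)) {a : ℝ → ℂ} (ha : IsH1Atom a) :
    ∫⁻ x, variationOp s n a x ≤
      (ENNReal.ofReal (338 * (β / (β - 1))) + 2) + 2 * ENNReal.ofReal (β / (β - 1)) := by
  obtain ⟨u, v, huv, hsupp, hbd⟩ := ha.2.1
  have h0 : 0 < v - u := sub_pos.2 huv
  set L := ENNReal.ofReal (v - u) with hL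
  have hL0 : L ≠ 0 := by simpa [hL] using huv
  have hLt : L ≠ ∞ := ENNReal.ofReal_ne_top
  -- Enlarging to the right is enough: the averages look backwards and vanish to the left of `u`.
  have hmeas : MeasurableSet (Set.Icc u (v + (v - u))) := measurableSet_Icc
  rw [← lintegral_add_compl _ hmeas]
  refine add_le_add ?_ ?_
  · have hI : volume (Set.Icc u (v + (v - u))) = 2 * L := by
      rw [Real.volume_Icc, show v + (v - u) - u = 2 * (v - u) by ring,
        ENNReal.ofReal_mul zero_le_two, ENNReal.ofReal_ofNat]
    set g : ℝ → ℝ≥0∞ := fun x => ∑' k,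
      ‖oneSidedAverage (n (k + 1)) a x - oneSidedAverage (n k) a x‖ₑ ^ (2 : ℝ) with hg
    have hVg : ∀ x, variationOp s n a x ≤ L * g x + L⁻¹ := fun x =>
      (ENNReal.tsum_rpow_rpow_le _ two_pos hs).trans (variationOp_two_le n a x hL0 hLt)
    calc ∫⁻ x in Set.Icc u (v + (v - u)), variationOp s n a x
        ≤ ∫⁻ x in Set.Icc u (v + (v - u)), (L * g x + L⁻¹) := lintegral_mono hVg
      _ = L * (∫⁻ x in Set.Icc u (v + (v - u)), g x) + L⁻¹ * (2 * L) := by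
          rw [lintegral_add_right _ measurable_const, lintegral_const_mul' _ _ hLt,
            setLIntegral_const, hI]
      _ ≤ L * (ENNReal.ofReal (338 * (β / (β - 1))) * L⁻¹) + L⁻¹ * (2 * L) := by
          gcongr
          refine (setLIntegral_le_lintegral _ _).trans
            ((lintegral_tsum_oneSidedAverage_sub_sq_le hβ hpos hn ha.integrable
              (ha.memLp 2)).trans ?_)
          gcongr
          exact lintegral_enorm_sq_le_of_atom huv hsupp hbd
      _ = ENNReal.ofReal (338 * (β / (β - 1))) + 2 := by
          rw [mul_left_comm, ENNReal.mul_inv_cancel hL0 hLt, mul_one, mul_left_comm,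
            ENNReal.inv_mul_cancel hL0 hLt, mul_one]
  · set F : ℕ → ℝ → ℝ≥0∞ := fun k => (Set.Icc (u + n k) (v + n k)).indicator
      (fun _ => if v - u ≤ n k then ENNReal.ofReal (n k)⁻¹ else 0) with hF
    have hFint : ∀ k, ∫⁻ x, F k x = ENNReal.ofReal (if v - u ≤ n k then (v - u) / n k else 0) := by
      intro k
      rw [hF, lintegral_indicator measurableSet_Icc, setLIntegral_const, Real.volume_Icc,
        add_sub_add_right_eq_sub]
      split_ifs
      · rw [mul_comm, ← ENNReal.ofReal_mul h0.le, div_eq_mul_inv]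
      · simp
    calc ∫⁻ x in (Set.Icc u (v + (v - u)))ᶜ, variationOp s n a x
        ≤ ∫⁻ x in (Set.Icc u (v + (v - u)))ᶜ, 2 * ∑' k, F k x := by
          refine setLIntegral_mono' hmeas.compl fun x hx => ?_
          refine (variationOp_le_tsum (by linarith) n a x).trans ?_
          gcongr with k
          exact enorm_oneSidedAverage_atom_le ha huv hsupp hbd (hpos k) hx
      _ ≤ ∫⁻ x, 2 * ∑' k, F k x := setLIntegral_le_lintegral _ _
      _ = 2 * ∑' k, ∫⁻ x, F k x := by
          rw [lintegral_const_mul' _ _ ENNReal.ofNat_ne_top, lintegral_tsum fun k =>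
            (measurable_const.indicator measurableSet_Icc).aemeasurable]
      _ ≤ 2 * ENNReal.ofReal (β / (β - 1)) := by
          gcongr
          refine ENNReal.tsum_le_of_sum_range_le fun K => ?_
          simp_rw [hFint]
          rw [← ENNReal.ofReal_sum_of_nonneg]
          · exact ENNReal.ofReal_le_ofReal (sum_indicator_inv_le hβ hpos hn h0 K)
          · intro k _
            split_ifs
            · exact div_nonneg h0.le (hpos k).le
            · exact le_rfl

/-! ### From atoms to `H¹` -/

theorem oneSidedAverage_sub {r : ℝ} (hr : 0 < r) {f g : ℝ → ℂ} (hf : Integrable f)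
    (hg : Integrable g) (x : ℝ) :
    oneSidedAverage r (fun y => f y - g y) x = oneSidedAverage r f x - oneSidedAverage r g x := by
  simp only [oneSidedAverage_eq_integral_Ioc hr]
  rw [integral_sub hf.integrableOn hg.integrableOn, mul_sub]

theorem oneSidedAverage_sum {r : ℝ} (hr : 0 < r) {ι : Type*} (t : Finset ι) (c : ι → ℂ)
    {a : ι → ℝ → ℂ} (ha : ∀ j, Integrable (a j)) (x : ℝ) :
    oneSidedAverage r (fun y => ∑ j ∈ t, c j * a j y) x =
      ∑ j ∈ t, c j * oneSidedAverage r (a j) x := by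
  simp only [oneSidedAverage_eq_integral_Ioc hr]
  rw [integral_finsetSum t fun j _ => ((ha j).const_mul (c j)).integrableOn, Finset.mul_sum]
  refine Finset.sum_congr rfl fun j _ => ?_
  rw [integral_const_mul]
  ring

/-- `A_r` maps `L¹` to bounded functions with norm at most `1/r`, so `L¹` convergence yields
convergence at every point, without passing to a subsequence. -/
theorem tendsto_oneSidedAverage_of_isAtomicDecomposition {f : ℝ → ℂ} (hf : Integrable f)
    {c : ℕ → ℂ} {a : ℕ → ℝ → ℂ} (h : IsAtomicDecomposition f c a) {r : ℝ} (hr : 0 < r) (x : ℝ) :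
    Tendsto (fun N => ∑ j ∈ Finset.range N, c j * oneSidedAverage r (a j) x) atTop
      (𝓝 (oneSidedAverage r f x)) := by
  have ha : ∀ j, Integrable (a j) := fun j => (h.1 j).integrable
  have hS : ∀ N, Integrable fun y => ∑ j ∈ Finset.range N, c j * a j y := fun N =>
    integrable_finsetSum _ fun j _ => (ha j).const_mul (c j)
  have h1 : Tendsto (fun N => r⁻¹ * ∫ y, ‖f y - ∑ j ∈ Finset.range N, c j * a j y‖) atTop
      (𝓝 0) := by
    have h2 := (ENNReal.tendsto_toReal ENNReal.zero_ne_top).comp h.2.2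
    have h3 := h2.const_mul r⁻¹
    rw [ENNReal.toReal_zero, mul_zero] at h3
    refine h3.congr fun N => ?_
    rw [Function.comp_apply, eLpNorm_one_eq_lintegral_enorm,
      ← integral_norm_eq_lintegral_enorm
        (f := fun y => f y - ∑ j ∈ Finset.range N, c j * a j y) (hf.sub (hS N)).1]
  rw [tendsto_iff_norm_sub_tendsto_zero]
  refine squeeze_zero (fun _ => norm_nonneg _) (fun N => ?_) h1
  rw [norm_sub_rev, ← oneSidedAverage_sum hr _ _ ha, ← oneSidedAverage_sub hr hf (hS N)]
  exact norm_oneSidedAverage_le hr (hf.sub (hS N)) x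

/-- Countable subadditivity of the variation operator along an atomic decomposition. -/
theorem variationOp_le_tsum_of_isAtomicDecomposition {s : ℝ} (hs : 1 ≤ s) {n : ℕ → ℝ}
    (hpos : ∀ k, 0 < n k) {f : ℝ → ℂ} (hf : Integrable f)
    {c : ℕ → ℂ} {a : ℕ → ℝ → ℂ} (h : IsAtomicDecomposition f c a) (x : ℝ) :
    variationOp s n f x ≤ ∑' j, ‖c j‖ₑ * variationOp s n (a j) x := by
  have hs0 : 0 < s := by linarith
  set B := ∑' j, ‖c j‖ₑ * variationOp s n (a j) x
  set D : (ℝ → ℂ) → ℕ → ℂ := fun g k => oneSidedAverage (n (k + 1)) g x - oneSidedAverage (n k) g x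
  change (∑' k, ‖D f k‖ₑ ^ s) ^ (1 / s) ≤ B
  rw [one_div, ENNReal.rpow_inv_le_iff hs0]
  -- Truncating in `k` lets the limit in `N` pass through a finite sum; only finite Minkowski is
  -- then needed.
  refine ENNReal.tsum_le_of_sum_range_le fun K => ?_
  have hlim : Tendsto (fun N => ∑ k ∈ Finset.range K,
      ‖∑ j ∈ Finset.range N, c j * D (a j) k‖ₑ ^ s) atTop
      (𝓝 (∑ k ∈ Finset.range K, ‖D f k‖ₑ ^ s)) := by
    refine tendsto_finsetSum _ fun k _ => ?_
    refine (ENNReal.continuous_rpow_const.tendsto _).comp ((continuous_enorm.tendsto _).comp ?_)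
    refine ((tendsto_oneSidedAverage_of_isAtomicDecomposition hf h (hpos (k + 1)) x).sub
      (tendsto_oneSidedAverage_of_isAtomicDecomposition hf h (hpos k) x)).congr fun N => ?_
    simp only [D, mul_sub, Finset.sum_sub_distrib]
  refine le_of_tendsto' hlim fun N => ?_
  rw [← ENNReal.rpow_inv_le_iff hs0, ← one_div]
  calc (∑ k ∈ Finset.range K, ‖∑ j ∈ Finset.range N, c j * D (a j) k‖ₑ ^ s) ^ (1 / s)
      ≤ (∑ k ∈ Finset.range K, (∑ j ∈ Finset.range N, ‖c j‖ₑ * ‖D (a j) k‖ₑ) ^ s) ^ (1 / s) := by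
        gcongr with k hk
        refine (enorm_sum_le _ _).trans (le_of_eq ?_)
        simp_rw [enorm_mul]
    _ ≤ ∑ j ∈ Finset.range N, (∑ k ∈ Finset.range K, (‖c j‖ₑ * ‖D (a j) k‖ₑ) ^ s) ^ (1 / s) :=
        ENNReal.Lp_sum_le _ _ (fun j k => ‖c j‖ₑ * ‖D (a j) k‖ₑ) hs
    _ ≤ ∑ j ∈ Finset.range N, ‖c j‖ₑ * variationOp s n (a j) x := by
        refine Finset.sum_le_sum fun j _ => ?_
        simp_rw [ENNReal.mul_rpow_of_nonneg _ _ hs0.le]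
        rw [← Finset.mul_sum, ENNReal.mul_rpow_of_nonneg _ _ (by positivity), ← ENNReal.rpow_mul,
          mul_one_div_cancel hs0.ne', ENNReal.rpow_one, variationOp]
        gcongr
        exact ENNReal.sum_le_tsum _
    _ ≤ B := ENNReal.sum_le_tsum _

theorem theorem1 (s : ℝ) (hs : 2 ≤ s) (n : ℕ → ℝ) (hn : IsLacunary n) :
    ∃ C : ℝ≥0, 0 < C ∧ ∀ f : ℝ → ℂ, MemH1 f →
      MemLp (variationOp s n f) 1 volume ∧
      eLpNorm (variationOp s n f) 1 volume ≤ (C : ℝ≥0∞) * h1Norm f := by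
  have hpos := hn.pos
  obtain ⟨-, β, hβ, hratio⟩ := hn
  have hn' : ∀ k, β * n k ≤ n (k + 1) := fun k => (le_div_iff₀ (hpos k)).1 (hratio k)
  set C : ℝ≥0 := (Real.toNNReal (338 * (β / (β - 1))) + 2) + 2 * Real.toNNReal (β / (β - 1))
  have hC : (C : ℝ≥0∞) =
      (ENNReal.ofReal (338 * (β / (β - 1))) + 2) + 2 * ENNReal.ofReal (β / (β - 1)) := by
    simp [C, ENNReal.ofReal]
  refine ⟨C, by positivity, fun f hf => ?_⟩
  obtain ⟨hfi, c₀, a₀, h₀⟩ := hf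
  have bound : ∀ c a, IsAtomicDecomposition f c a →
      eLpNorm (variationOp s n f) 1 volume ≤ (C : ℝ≥0∞) * ∑' j, ‖c j‖ₑ := by
    intro c a h
    rw [eLpNorm_one_eq_lintegral_enorm]
    calc ∫⁻ x, ‖variationOp s n f x‖ₑ ≤ ∫⁻ x, ∑' j, ‖c j‖ₑ * variationOp s n (a j) x :=
          lintegral_mono fun x =>
            variationOp_le_tsum_of_isAtomicDecomposition (by linarith) hpos hfi h x
      _ = ∑' j, ‖c j‖ₑ * ∫⁻ x, variationOp s n (a j) x := by
          rw [lintegral_tsum fun j =>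
            (aemeasurable_variationOp s hpos (h.1 j).integrable).const_mul _]
          simp_rw [lintegral_const_mul' _ _ enorm_ne_top]
      _ ≤ ∑' j, ‖c j‖ₑ * C := by
          gcongr with j
          rw [hC]
          exact lintegral_variationOp_atom_le hs hβ hpos hn' (h.1 j)
      _ = C * ∑' j, ‖c j‖ₑ := by rw [ENNReal.tsum_mul_right, mul_comm]
  refine ⟨⟨(aemeasurable_variationOp s hpos hfi).aestronglyMeasurable, ?_⟩, ?_⟩
  · refine (bound c₀ a₀ h₀).trans_lt (ENNReal.mul_lt_top ENNReal.coe_lt_top ?_)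
    have : Summable fun j => ‖c₀ j‖₊ := by
      rw [← NNReal.summable_coe]; exact h₀.2.1
    simpa [enorm_eq_nnnorm] using (ENNReal.tsum_coe_ne_top_iff_summable.2 this).lt_top
  · rw [h1Norm]
    -- Multiplication by `C` commutes with the infimum because `C` is neither `0` nor `∞`.
    simp_rw [ENNReal.mul_iInf_of_ne (ENNReal.coe_ne_zero.2 (show C ≠ 0 by positivity))
      ENNReal.coe_ne_top]
    exact le_iInf fun c => le_iInf fun a => le_iInf fun h => bound c a h
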